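/- For $\lambda\ge 0$ put $d\Omega_\lambda(x)=(1-x^2)^{\lambda-1/2}\,dx$ on $[-1,1]$. For $\lambda>0$ let $$C_\lambda(x,y,z)=\frac{\Gamma(\lambda+\frac12)}{\sqrt\pi\,\Gamma(\lambda)}\,\frac{(1-x^2-y^2-z^2+2xyz)^{\lambda-1}}{\bigl[(1-x^2)(1-y^2)(1-z^2)\bigr]^{\lambda-1/2}}$$ if $1-x^2-y^2-z^2+2xyz>0$, and $C_\lambda(x,y,z)=0$ otherwise. Define the Gegenbauer convolution of functions $f,g$ on $[-1,1]$ by $$(f\star_\lambda g)(x)=\int_{-1}^1\int_{-1}^1 f(y)\,g(z)\,C_\lambda(x,y,z)\,d\Omega_\lambda(y)\,d\Omega_\lambda(z)\quad(\lambda>0),$$ $$(f\star_0 g)(\cos\theta)=\frac12\int_{-\pi}^{\pi} f(\cos(\theta-t))\,g(\cos t)\,dt .$$ Let $(\mathcal I f)(x)=\int_{-1}^x f(u)\,du$ and $\mathcal D h=h'$. **Theorem.** Let $\lambda\ge 0$ be real, let $f,g\in L^1[-1,1]$ be real-valued, and assume that $(\mathcal I f)\star_\lambda(\mathcal I g)$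 is absolutely continuous, in the sense that it agrees almost everywhere on $[-1,1]$ with a function that is absolutely continuous on $[-1,1]$. Then, for almost every $x\in[-1,1]$, the function $(\mathcal I f)\star_\lambda(\mathcal I g)$ is differentiable at $x$ and $$(f\star_{\lambda+1} g)(x)=(2\lambda+1)\,\mathcal D\bigl[(\mathcal I f)\star_\lambda(\mathcal I g)\bigr](x).$$ -/

import Mathlib

open MeasureTheory Set

noncomputable section

namespace SphereConv

/-- The montée operator `(I f)(x) = ∫_{-1}^x f(u) du`. -/
def montee (f : ℝ → ℝ) (x : ℝ) : ℝ := ∫ u in (-1 : ℝ)..x, f u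

/-- The descente operator `(D f)(x) = f'(x)`. -/
def descente (f : ℝ → ℝ) (x : ℝ) : ℝ := deriv f x

/-- The measure `dΩ_lam(x) = (1 - x^2)^(lam - 1/2) dx` on `[-1, 1]`. -/
def gegenbauerMeasure (lam : ℝ) : Measure ℝ :=
  (volume.restrict (Icc (-1 : ℝ) 1)).withDensity
    fun x => ENNReal.ofReal ((1 - x ^ 2) ^ (lam - 1 / 2))

/-- The polynomial `1 - x^2 - y^2 - z^2 + 2xyz`. -/
def gegenbauerDelta (x y z : ℝ) : ℝ := 1 - x ^ 2 - y ^ 2 - z ^ 2 + 2 * x * y * z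

/-- The kernel `C_lam(x, y, z)`, `lam > 0`, of Gegenbauer's product formula
`∫ W_n(x) C_lam(x, y, z) dΩ_lam(x) = W_n(y) W_n(z)`, where `W_n` is the ultraspherical polynomial
of index `lam` normalized by `W_n(1) = 1`. It is the usual form
`W_n(y) W_n(z) = c ∫_0^π W_n(yz + √(1 - y^2) √(1 - z^2) cos φ) (sin φ)^(2 lam - 1) dφ` of that
formula, with `c = Γ(lam + 1/2) / (√π Γ(lam))`, after the substitution
`x = yz + √(1 - y^2) √(1 - z^2) cos φ`. -/
def gegenbauerKernel (lam x y z : ℝ) : ℝ :=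
  if 0 < gegenbauerDelta x y z then
    Real.Gamma (lam + 1 / 2) / (Real.sqrt Real.pi * Real.Gamma lam) *
      gegenbauerDelta x y z ^ (lam - 1) *
      ((1 - x ^ 2) * (1 - y ^ 2) * (1 - z ^ 2)) ^ (1 / 2 - lam)
  else 0

/-- The Gegenbauer convolution of two functions on `[-1, 1]`, as a function of `x ∈ [-1, 1]`.
For `lam > 0` it is the double integral against the kernel; for `lam = 0` it is
`(f ⋆ g)(cos θ) = (1/2) ∫_{-π}^π f(cos(θ - t)) g(cos t) dt`. -/
def gegenbauerConv (lam : ℝ) (f g : ℝ → ℝ) (x : ℝ) : ℝ :=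
  if lam = 0 then
    1 / 2 * ∫ t in (-Real.pi)..Real.pi, f (Real.cos (Real.arccos x - t)) * g (Real.cos t)
  else
    ∫ z, ∫ y, f y * g z * gegenbauerKernel lam x y z
      ∂(gegenbauerMeasure lam) ∂(gegenbauerMeasure lam)

/-- `h`, regarded as an element of a space of functions modulo equality almost everywhere on
`[-1, 1]`, is absolutely continuous: it has a representative that is absolutely continuous on
the closed interval `[-1, 1]`. -/
def HasACRepresentative (h : ℝ → ℝ) : Prop :=
  ∃ H : ℝ → ℝ, AbsolutelyContinuousOnInterval H (-1) 1 ∧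
    h =ᵐ[volume.restrict (Icc (-1 : ℝ) 1)] H

end SphereConv

end

/-!
The formula holds, with a genuine derivative, at every point of `(-1, 1)`
(`hasDerivAt_gegenbauerConv_montee`). It is an integration by parts for `C¹` functions, which
passes to `L¹` limits.

With `F = montee f`, `G = montee g`, `x = cos θ`, and the substitutions `z = cos τ`,
`y = W = cos θ cos τ + sin θ sin τ cos φ`, the convolution of index `ν > 0` becomes
`c_ν ∫∫ G(cos τ) F(W) sin^(2ν) τ sin^(2ν-1) φ dφ dτ` over `(0, π)²`
(`gegenbauerConv_eq_integral_angle`). Differentiation in `θ` puts `f(W) ∂_θW` under the integral. The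
divergence theorem on the square, for a vector field built from `G(cos τ) f(W)` and powers of the
sines (`integral_angle_divergence`), moves the derivative from `F` to `G`, at the price of raising
both exponents by `2`: the result is the convolution of `f` and `g` of index `ν + 1`, and the
constants agree because `2ν c_(ν+1) = (2ν+1) c_ν`. For `lam = 0` the same computation takes place on
the circle (`hasDerivAt_gegenbauerConv_zero`).

For the passage to the limit, the kernel of index `lam + 1 ≥ 1`, taken together with the densities
of the two measures, is bounded by a constant times `(1 - x²)^(-lam-1/2)`
(`abs_weightedKernel_le`). Hence `L¹` convergence of `f` and `g` gives locally uniform convergence of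
`f ⋆_(lam+1) g` on `(-1, 1)` (`abs_gegenbauerConv_sub_le`), while `F` and `G` converge uniformly and
`F ⋆_lam G` pointwise (`tendsto_gegenbauerConv`); a pointwise limit of functions whose derivatives
converge uniformly may be differentiated term by term.
-/

noncomputable section

namespace SphereConv

open Real (cos sin)

/-! ### The spherical law of cosines as a parametrization of the kernel -/

/-- The cosine of the side opposite to the angle `φ` in the spherical triangle whose two other
sides are `θ` and `τ` (spherical law of cosines). For fixed `θ` and `τ` it parametrizes the
support of the kernel `C_ν(cos θ, ·, cos τ)` by `φ ∈ (0, π)`. -/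
def sphArg (θ τ φ : ℝ) : ℝ := cos θ * cos τ + sin θ * sin τ * cos φ

/-- The constant `Γ(ν + 1/2) / (√π Γ(ν))` of the kernel `C_ν`. -/
def kernelConst (ν : ℝ) : ℝ := Real.Gamma (ν + 1 / 2) / (√Real.pi * Real.Gamma ν)

theorem continuous_sphArg (θ : ℝ) : Continuous fun p : ℝ × ℝ => sphArg θ p.1 p.2 := by
  unfold sphArg; fun_prop

theorem abs_sphArg_le_one (θ τ φ : ℝ) : |sphArg θ τ φ| ≤ 1 := by
  have h1 := Real.sin_sq_add_cos_sq θ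
  have h2 := Real.sin_sq_add_cos_sq τ
  have h3 := Real.sin_sq_add_cos_sq φ
  have : sphArg θ τ φ ^ 2 ≤ 1 := by
    unfold sphArg
    have key : 1 - (cos θ * cos τ + sin θ * sin τ * cos φ) ^ 2
        = (cos θ * sin τ - sin θ * cos τ * cos φ) ^ 2 + (sin θ * sin φ) ^ 2 := by
      have e1 : cos θ ^ 2 = 1 - sin θ ^ 2 := by linarith
      have e2 : cos τ ^ 2 = 1 - sin τ ^ 2 := by linarith
      have e3 : cos φ ^ 2 = 1 - sin φ ^ 2 := by linarith
      ring_nf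
      simp only [e1, e2, e3]
      ring
    nlinarith [sq_nonneg (cos θ * sin τ - sin θ * cos τ * cos φ), sq_nonneg (sin θ * sin φ)]
  exact abs_le_one_iff_mul_self_le_one.mpr (by nlinarith)

theorem gegenbauerDelta_cos (θ y τ : ℝ) :
    gegenbauerDelta (cos θ) y (cos τ) = (sin θ * sin τ) ^ 2 - (y - cos θ * cos τ) ^ 2 := by
  have h1 := Real.sin_sq_add_cos_sq θ
  have h2 := Real.sin_sq_add_cos_sq τ
  have e1 : sin θ ^ 2 = 1 - cos θ ^ 2 := by linarith
  have e2 : sin τ ^ 2 = 1 - cos τ ^ 2 := by linarith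
  rw [mul_pow, e1, e2, gegenbauerDelta]; ring

theorem image_cos_Ioo : cos '' Ioo 0 Real.pi = Ioo (-1) 1 := by
  ext x
  constructor
  · rintro ⟨t, ht, rfl⟩
    have h0 := Real.strictAntiOn_cos (left_mem_Icc.2 Real.pi_pos.le) (Ioo_subset_Icc_self ht) ht.1
    have h1 := Real.strictAntiOn_cos (Ioo_subset_Icc_self ht) (right_mem_Icc.2 Real.pi_pos.le) ht.2
    simp only [Real.cos_zero, Real.cos_pi] at h0 h1
    exact ⟨h1, h0⟩
  · intro hx
    exact ⟨Real.arccos x, ⟨Real.arccos_pos.2 hx.2, Real.arccos_lt_pi.2 hx.1⟩,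
      Real.cos_arccos hx.1.le hx.2.le⟩

/-- For `θ, τ ∈ (0, π)` the set where the kernel is nonzero is the range of `φ ↦ sphArg θ τ φ`
on `(0, π)`. -/
theorem image_sphArg_Ioo {θ τ : ℝ} (hθ : θ ∈ Ioo 0 Real.pi) (hτ : τ ∈ Ioo 0 Real.pi) :
    sphArg θ τ '' Ioo 0 Real.pi = {y | 0 < gegenbauerDelta (cos θ) y (cos τ)} := by
  have hs : 0 < sin θ * sin τ :=
    mul_pos (Real.sin_pos_of_mem_Ioo hθ) (Real.sin_pos_of_mem_Ioo hτ)
  have e : sphArg θ τ = (fun u => cos θ * cos τ + sin θ * sin τ * u) ∘ cos := by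
    ext φ; simp [sphArg]
  rw [e, image_comp, image_cos_Ioo]
  ext y
  rw [mem_ofPred_eq, gegenbauerDelta_cos, sub_pos, sq_lt_sq, abs_of_pos hs, abs_lt]
  constructor
  · rintro ⟨u, hu, rfl⟩
    constructor <;> nlinarith [hu.1, hu.2]
  · rintro ⟨h1, h2⟩
    refine ⟨(y - cos θ * cos τ) / (sin θ * sin τ), ⟨?_, ?_⟩, ?_⟩
    · rw [lt_div_iff₀ hs]; linarith
    · rw [div_lt_iff₀ hs]; linarith
    · simp only [mul_comm (sin θ * sin τ), div_mul_cancel₀ _ hs.ne']; ring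

theorem hasDerivAt_sphArg_polar (θ τ φ : ℝ) :
    HasDerivAt (sphArg θ τ) (-(sin θ * sin τ * sin φ)) φ := by
  unfold sphArg
  simpa using ((Real.hasDerivAt_cos φ).const_mul (sin θ * sin τ)).const_add (cos θ * cos τ)

theorem injOn_sphArg {θ τ : ℝ} (hθ : θ ∈ Ioo 0 Real.pi) (hτ : τ ∈ Ioo 0 Real.pi) :
    InjOn (sphArg θ τ) (Ioo 0 Real.pi) := by
  have hs : 0 < sin θ * sin τ :=
    mul_pos (Real.sin_pos_of_mem_Ioo hθ) (Real.sin_pos_of_mem_Ioo hτ)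
  intro a ha b hb hab
  refine Real.injOn_cos (Ioo_subset_Icc_self ha) (Ioo_subset_Icc_self hb) ?_
  exact mul_left_cancel₀ hs.ne' (add_left_cancel hab)

/-! ### The convolution in angular variables -/

theorem integral_gegenbauerMeasure (ν : ℝ) (h : ℝ → ℝ) :
    ∫ y, h y ∂gegenbauerMeasure ν = ∫ y in Ioo (-1 : ℝ) 1, (1 - y ^ 2) ^ (ν - 1 / 2) * h y := by
  unfold gegenbauerMeasure
  rw [integral_withDensity_eq_integral_toReal_smul (by fun_prop) (by simp),
    integral_Icc_eq_integral_Ioo]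
  refine setIntegral_congr_fun measurableSet_Ioo fun y hy => ?_
  have : 0 ≤ 1 - y ^ 2 := by nlinarith [hy.1, hy.2]
  simp only [smul_eq_mul, ENNReal.toReal_ofReal (Real.rpow_nonneg this _)]

theorem integral_gegenbauerMeasure_eq_cos (ν : ℝ) (h : ℝ → ℝ) :
    ∫ y, h y ∂gegenbauerMeasure ν = ∫ τ in Ioo 0 Real.pi, sin τ ^ (2 * ν) * h (cos τ) := by
  rw [integral_gegenbauerMeasure, ← image_cos_Ioo,
    integral_image_eq_integral_abs_deriv_smul measurableSet_Ioo
      (fun x _ => (Real.hasDerivAt_cos x).hasDerivWithinAt)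
      (Real.injOn_cos.mono Ioo_subset_Icc_self)]
  refine setIntegral_congr_fun measurableSet_Ioo fun τ hτ => ?_
  have hs := Real.sin_pos_of_mem_Ioo hτ
  have e : 1 - cos τ ^ 2 = sin τ ^ (2 : ℝ) := by
    rw [Real.rpow_two]; linarith [Real.sin_sq_add_cos_sq τ]
  simp only [smul_eq_mul, abs_neg, abs_of_pos hs]
  rw [e, ← Real.rpow_mul hs.le, ← mul_assoc]
  congr 1
  nth_rewrite 1 [← Real.rpow_one (sin τ)]
  rw [← Real.rpow_add hs]
  congr 1; ring

/-- Gegenbauer's product formula for the kernel, with integration in the middle variable: the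
substitution `y = sphArg θ τ φ` turns `Δ` into `(sin θ sin τ sin φ)²`, and all powers of `sin θ`,
`sin τ` and `1 - y²` cancel. No integrability of `f` is needed. -/
theorem integral_mul_gegenbauerKernel {θ τ : ℝ} (ν : ℝ) (hθ : θ ∈ Ioo 0 Real.pi)
    (hτ : τ ∈ Ioo 0 Real.pi) (f : ℝ → ℝ) :
    ∫ y, f y * gegenbauerKernel ν (cos θ) y (cos τ) ∂gegenbauerMeasure ν =
      kernelConst ν * ∫ φ in Ioo 0 Real.pi, sin φ ^ (2 * ν - 1) * f (sphArg θ τ φ) := by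
  have hsθ := Real.sin_pos_of_mem_Ioo hθ
  have hsτ := Real.sin_pos_of_mem_Ioo hτ
  have hsub : {y | 0 < gegenbauerDelta (cos θ) y (cos τ)} ⊆ Ioo (-1) 1 := by
    rw [← image_sphArg_Ioo hθ hτ]
    rintro _ ⟨φ, hφ, rfl⟩
    have hsφ := Real.sin_pos_of_mem_Ioo hφ
    have h1 := Real.sin_sq_add_cos_sq θ
    have h2 := Real.sin_sq_add_cos_sq τ
    have h3 := Real.sin_sq_add_cos_sq φ
    have hp := mul_pos hsθ hsτ
    have hc : -1 < cos φ ∧ cos φ < 1 := by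
      constructor <;> nlinarith
    unfold sphArg
    constructor <;>
      nlinarith [sq_nonneg (sin θ - sin τ), sq_nonneg (cos θ + cos τ), sq_nonneg (cos θ - cos τ)]
  have hmeas : MeasurableSet {y | 0 < gegenbauerDelta (cos θ) y (cos τ)} :=
    measurableSet_lt measurable_const (by unfold gegenbauerDelta; fun_prop)
  rw [integral_gegenbauerMeasure]
  have hind : ∀ y, (1 - y ^ 2) ^ (ν - 1 / 2) * (f y * gegenbauerKernel ν (cos θ) y (cos τ)) =
      {y | 0 < gegenbauerDelta (cos θ) y (cos τ)}.indicator (fun y =>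
        (1 - y ^ 2) ^ (ν - 1 / 2) * (f y * gegenbauerKernel ν (cos θ) y (cos τ))) y := by
    intro y
    by_cases hy : 0 < gegenbauerDelta (cos θ) y (cos τ)
    · rw [indicator_of_mem (by exact hy)]
    · rw [indicator_of_notMem (by exact hy), gegenbauerKernel, if_neg hy]; simp
  rw [integral_congr_ae (Filter.Eventually.of_forall hind), setIntegral_indicator hmeas,
    inter_eq_right.2 hsub, ← image_sphArg_Ioo hθ hτ,
    integral_image_eq_integral_abs_deriv_smul measurableSet_Ioo
      (fun x _ => (hasDerivAt_sphArg_polar θ τ x).hasDerivWithinAt) (injOn_sphArg hθ hτ),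
    ← integral_const_mul]
  refine setIntegral_congr_fun measurableSet_Ioo fun φ hφ => ?_
  have hsφ := Real.sin_pos_of_mem_Ioo hφ
  have hmem : sphArg θ τ φ ∈ {y | 0 < gegenbauerDelta (cos θ) y (cos τ)} := by
    rw [← image_sphArg_Ioo hθ hτ]; exact mem_image_of_mem _ hφ
  have hpos : 0 < gegenbauerDelta (cos θ) (sphArg θ τ φ) (cos τ) := hmem
  have hW : 0 < 1 - sphArg θ τ φ ^ 2 := by
    have := hsub hmem; nlinarith [this.1, this.2]
  have hΔ : gegenbauerDelta (cos θ) (sphArg θ τ φ) (cos τ) = (sin θ * sin τ * sin φ) ^ (2 : ℝ) := by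
    rw [gegenbauerDelta_cos, sphArg, Real.rpow_two]
    linear_combination (-(sin θ * sin τ) ^ 2) * Real.sin_sq_add_cos_sq φ
  have e1 : 1 - cos θ ^ 2 = sin θ ^ (2 : ℝ) := by
    rw [Real.rpow_two]; linarith [Real.sin_sq_add_cos_sq θ]
  have e2 : 1 - cos τ ^ 2 = sin τ ^ (2 : ℝ) := by
    rw [Real.rpow_two]; linarith [Real.sin_sq_add_cos_sq τ]
  simp only [smul_eq_mul, abs_neg, abs_of_pos (mul_pos (mul_pos hsθ hsτ) hsφ)]
  rw [gegenbauerKernel, if_pos hpos, hΔ, e1, e2, ← Real.rpow_mul (by positivity),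
    Real.mul_rpow (by positivity) (by positivity), Real.mul_rpow (by positivity) (by positivity),
    Real.mul_rpow (by positivity) (by positivity), Real.mul_rpow (by positivity) (by positivity),
    ← Real.rpow_mul hsθ.le, ← Real.rpow_mul hsτ.le]
  have c0 : (1 - sphArg θ τ φ ^ 2) ^ (ν - 1 / 2) * (1 - sphArg θ τ φ ^ 2) ^ (1 / 2 - ν) = 1 := by
    rw [← Real.rpow_add hW]; norm_num
  have cc : ∀ s : ℝ, 0 < s → s * (s ^ (2 * (ν - 1)) * s ^ (2 * (1 / 2 - ν))) = 1 := by
    intro s hs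
    rw [← Real.rpow_add hs]
    nth_rewrite 1 [← Real.rpow_one s]
    rw [← Real.rpow_add hs]
    ring_nf; simp
  have c3 : sin φ * sin φ ^ (2 * (ν - 1)) = sin φ ^ (2 * ν - 1) := by
    nth_rewrite 1 [← Real.rpow_one (sin φ)]
    rw [← Real.rpow_add hsφ]
    ring_nf
  have c1 := cc _ hsθ
  have c2 := cc _ hsτ
  rw [← c3, kernelConst]
  calc _ = (Real.Gamma (ν + 1 / 2) / (√Real.pi * Real.Gamma ν)) *
      (sin φ * sin φ ^ (2 * (ν - 1)) * f (sphArg θ τ φ)) *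
      ((1 - sphArg θ τ φ ^ 2) ^ (ν - 1 / 2) * (1 - sphArg θ τ φ ^ 2) ^ (1 / 2 - ν)) *
      (sin θ * (sin θ ^ (2 * (ν - 1)) * sin θ ^ (2 * (1 / 2 - ν)))) *
      (sin τ * (sin τ ^ (2 * (ν - 1)) * sin τ ^ (2 * (1 / 2 - ν)))) := by ring
    _ = _ := by rw [c0, c1, c2]; ring

/-- The convolution in angular variables. -/
theorem gegenbauerConv_eq_iterated {θ ν : ℝ} (hν : 0 < ν) (hθ : θ ∈ Ioo 0 Real.pi)
    (f g : ℝ → ℝ) :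
    gegenbauerConv ν f g (cos θ) = kernelConst ν * ∫ τ in Ioo 0 Real.pi, sin τ ^ (2 * ν) *
      (g (cos τ) * ∫ φ in Ioo 0 Real.pi, sin φ ^ (2 * ν - 1) * f (sphArg θ τ φ)) := by
  rw [gegenbauerConv, if_neg hν.ne', integral_gegenbauerMeasure_eq_cos, ← integral_const_mul]
  refine setIntegral_congr_fun measurableSet_Ioo fun τ hτ => ?_
  have : ∀ y, f y * g (cos τ) * gegenbauerKernel ν (cos θ) y (cos τ) =
      g (cos τ) * (f y * gegenbauerKernel ν (cos θ) y (cos τ)) := fun y => by ring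
  simp only [this, integral_const_mul, integral_mul_gegenbauerKernel ν hθ hτ]
  ring

/-- The convolution only sees the values of its arguments on `[-1, 1]`. -/
theorem gegenbauerConv_congr (lam : ℝ) {f f' g g' : ℝ → ℝ} (hf : EqOn f f' (Icc (-1) 1))
    (hg : EqOn g g' (Icc (-1) 1)) : gegenbauerConv lam f g = gegenbauerConv lam f' g' := by
  ext x
  unfold gegenbauerConv
  split_ifs with h
  · simp only [hf (Real.cos_mem_Icc _), hg (Real.cos_mem_Icc _)]
  · simp only [integral_gegenbauerMeasure]
    refine setIntegral_congr_fun measurableSet_Ioo fun z hz => ?_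
    simp only [hg (Ioo_subset_Icc_self hz)]
    congr 1
    refine setIntegral_congr_fun measurableSet_Ioo fun y hy => ?_
    simp only [hf (Ioo_subset_Icc_self hy)]

/-! ### Integration over pairs of angles -/

/-- The function `2ν sin^(2ν-1)` is the derivative of the continuous function
`(2ν+1) ∫ sin^(2ν+1) + cos · sin^(2ν)`, and a nonnegative derivative is integrable. -/
theorem integrableOn_sin_rpow {ν : ℝ} (hν : 0 < ν) :
    IntegrableOn (fun φ => sin φ ^ (2 * ν - 1)) (Ioo 0 Real.pi) := by
  have hc : Continuous fun φ => sin φ ^ (2 * ν + 1) :=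
    Real.continuous_sin.rpow_const fun _ => Or.inr (by linarith)
  have hc' : Continuous fun φ => sin φ ^ (2 * ν) :=
    Real.continuous_sin.rpow_const fun _ => Or.inr (by linarith)
  have hd : ∀ φ ∈ Ioo 0 Real.pi, HasDerivAt (fun φ => (2 * ν + 1) * (∫ t in (0 : ℝ)..φ,
      sin t ^ (2 * ν + 1)) + cos φ * sin φ ^ (2 * ν)) (2 * ν * sin φ ^ (2 * ν - 1)) φ := by
    intro φ hφ
    have hs := Real.sin_pos_of_mem_Ioo hφ
    have h := ((intervalIntegral.integral_hasDerivAt_right (hc.intervalIntegrable 0 φ)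
      (hc.stronglyMeasurableAtFilter _ _) hc.continuousAt).const_mul (2 * ν + 1)).add
      ((Real.hasDerivAt_cos φ).mul
        ((Real.hasDerivAt_sin φ).rpow_const (p := 2 * ν) (Or.inl hs.ne')))
    refine h.congr_deriv ?_
    have e1 : sin φ ^ (2 * ν + 1) = sin φ ^ (2 * ν - 1) * sin φ ^ 2 := by
      rw [← Real.rpow_two, ← Real.rpow_add hs]; ring_nf
    have e2 : sin φ ^ (2 * ν) = sin φ ^ (2 * ν - 1) * sin φ := by
      rw [← Real.rpow_add_one hs.ne']; ring_nf
    rw [e1, e2]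
    linear_combination (2 * ν * sin φ ^ (2 * ν - 1)) * Real.sin_sq_add_cos_sq φ
  have h := intervalIntegral.integrableOn_deriv_of_nonneg (Continuous.continuousOn (by
    have := intervalIntegral.continuous_primitive (μ := volume)
      (fun a b => hc.intervalIntegrable a b) 0
    fun_prop)) hd (fun φ hφ => by
      have hs := Real.sin_pos_of_mem_Ioo hφ
      positivity)
  have h2 := (h.mono_set Ioo_subset_Ioc_self).const_mul (2 * ν)⁻¹
  refine h2.congr (Filter.Eventually.of_forall fun φ => ?_)
  simp only
  field_simp

/-- Lebesgue measure on the square `(0, π)²` of pairs `(τ, φ)`. -/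
def angleMeasure : Measure (ℝ × ℝ) :=
  (volume.restrict (Ioo 0 Real.pi)).prod (volume.restrict (Ioo 0 Real.pi))

instance : IsFiniteMeasure angleMeasure := by unfold angleMeasure; infer_instance

/-- The weight `sin^(2ν) τ · sin^(2ν-1) φ` of the convolution in angular variables; it is
unbounded, but integrable, on `(0, π)²` when `0 < ν < 1/2`. -/
def angleWeight (ν : ℝ) (p : ℝ × ℝ) : ℝ := sin p.1 ^ (2 * ν) * sin p.2 ^ (2 * ν - 1)

theorem ae_angleMeasure_mem :
    ∀ᵐ p ∂angleMeasure, p.1 ∈ Ioo 0 Real.pi ∧ p.2 ∈ Ioo 0 Real.pi := by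
  rw [angleMeasure, Measure.prod_restrict]
  filter_upwards [ae_restrict_mem (measurableSet_Ioo.prod measurableSet_Ioo)] with p hp
  exact hp

theorem integrable_angleWeight {ν : ℝ} (hν : 0 < ν) : Integrable (angleWeight ν) angleMeasure := by
  have hc : Continuous fun φ => sin φ ^ (2 * ν) :=
    Real.continuous_sin.rpow_const fun _ => Or.inr (by linarith)
  exact Integrable.mul_prod (hc.integrableOn_Ioc.mono_set Ioo_subset_Ioc_self)
    (integrableOn_sin_rpow hν)

theorem integrable_mul_angleWeight {ν : ℝ} (hν : 0 < ν) {h : ℝ × ℝ → ℝ} {M : ℝ}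
    (hh : AEStronglyMeasurable h angleMeasure) (hM : ∀ p, |h p| ≤ M) :
    Integrable (fun p => h p * angleWeight ν p) angleMeasure :=
  (integrable_angleWeight hν).bdd_mul hh (Filter.Eventually.of_forall hM)

theorem integrable_angleMeasure_of_continuous {h : ℝ × ℝ → ℝ} (hh : Continuous h) :
    Integrable h angleMeasure := by
  rw [angleMeasure, Measure.prod_restrict]
  exact (hh.continuousOn.integrableOn_compact (isCompact_Icc.prod isCompact_Icc)).mono_set
    (prod_mono Ioo_subset_Icc_self Ioo_subset_Icc_self)

theorem exists_abs_le_of_continuous {f : ℝ → ℝ} (hf : Continuous f) :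
    ∃ M, 0 ≤ M ∧ ∀ x, |x| ≤ 1 → |f x| ≤ M := by
  obtain ⟨M, hM⟩ := (isCompact_Icc (a := (-1 : ℝ)) (b := 1)).exists_bound_of_continuousOn
    hf.continuousOn
  exact ⟨M, (norm_nonneg _).trans (hM 0 (by norm_num)), fun x hx => hM x (abs_le.1 hx)⟩

theorem gegenbauerConv_eq_integral_angle {θ ν : ℝ} (hν : 0 < ν) (hθ : θ ∈ Ioo 0 Real.pi)
    {f g : ℝ → ℝ} (hf : Continuous f) (hg : Continuous g) :
    gegenbauerConv ν f g (cos θ) = kernelConst ν *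
      ∫ p, g (cos p.1) * f (sphArg θ p.1 p.2) * angleWeight ν p ∂angleMeasure := by
  obtain ⟨Mf, hMf, hf'⟩ := exists_abs_le_of_continuous hf
  obtain ⟨Mg, hMg, hg'⟩ := exists_abs_le_of_continuous hg
  have hcont := continuous_sphArg θ
  have hint : Integrable (fun p : ℝ × ℝ =>
      g (cos p.1) * f (sphArg θ p.1 p.2) * angleWeight ν p) angleMeasure := by
    refine integrable_mul_angleWeight hν (M := Mg * Mf) (Continuous.aestronglyMeasurable ?_) ?_
    · fun_prop
    · intro p
      rw [abs_mul]
      exact mul_le_mul (hg' _ (Real.abs_cos_le_one _)) (hf' _ (abs_sphArg_le_one _ _ _))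
        (abs_nonneg _) hMg
  rw [gegenbauerConv_eq_iterated hν hθ, angleMeasure, integral_prod _ hint]
  congr 1
  refine integral_congr_ae (Filter.Eventually.of_forall fun τ => ?_)
  simp only [← integral_const_mul]
  refine integral_congr_ae (Filter.Eventually.of_forall fun φ => ?_)
  simp only [angleWeight]
  ring

/-! ### The derivative formula for `C¹` functions -/

theorem hasDerivAt_sphArg_left (θ τ φ : ℝ) : HasDerivAt (fun θ => sphArg θ τ φ)
    (-sin θ * cos τ + cos θ * sin τ * cos φ) θ := by
  unfold sphArg
  exact ((Real.hasDerivAt_cos θ).mul_const _).add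
    (((Real.hasDerivAt_sin θ).mul_const _).mul_const _)

theorem hasDerivAt_sphArg_mid (θ τ φ : ℝ) : HasDerivAt (fun τ => sphArg θ τ φ)
    (-cos θ * sin τ + sin θ * cos τ * cos φ) τ := by
  unfold sphArg
  refine (((Real.hasDerivAt_cos τ).const_mul (cos θ)).add
    (((Real.hasDerivAt_sin τ).const_mul (sin θ)).mul_const (cos φ))).congr_deriv (by ring)

/-- A bound for the partial derivatives of `sphArg` in its first two arguments. -/
theorem abs_mul_add_mul_mul_le_two {a b c d e : ℝ} (ha : |a| ≤ 1) (hb : |b| ≤ 1) (hc : |c| ≤ 1)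
    (hd : |d| ≤ 1) (he : |e| ≤ 1) : |-a * b + c * d * e| ≤ 2 := by
  have h1 : |-a * b| ≤ 1 := by
    rw [abs_mul, abs_neg]
    exact mul_le_one₀ ha (abs_nonneg _) hb
  have h2 : |c * d * e| ≤ 1 := by
    rw [abs_mul, abs_mul]
    exact mul_le_one₀ (mul_le_one₀ hc (abs_nonneg _) hd) (abs_nonneg _) he
  linarith [abs_add_le (-a * b) (c * d * e)]

theorem hasDerivAt_integral_angle {ν : ℝ} (hν : 0 < ν) {F f G : ℝ → ℝ}
    (hF : ∀ u, HasDerivAt F (f u) u) (hf : Continuous f) (hG : Continuous G) (θ : ℝ) :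
    HasDerivAt (fun θ => ∫ p, G (cos p.1) * F (sphArg θ p.1 p.2) * angleWeight ν p ∂angleMeasure)
      (∫ p, G (cos p.1) * (f (sphArg θ p.1 p.2) *
        (-sin θ * cos p.1 + cos θ * sin p.1 * cos p.2)) * angleWeight ν p ∂angleMeasure) θ := by
  have hFc : Continuous F := continuous_iff_continuousAt.2 fun u => (hF u).continuousAt
  obtain ⟨Mf, hMf, hf'⟩ := exists_abs_le_of_continuous hf
  obtain ⟨MF, hMF, hF'⟩ := exists_abs_le_of_continuous hFc
  obtain ⟨Mg, hMg, hg'⟩ := exists_abs_le_of_continuous hG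
  have hw := integrable_angleWeight hν
  have hmeas : ∀ θ, AEStronglyMeasurable
      (fun p : ℝ × ℝ => G (cos p.1) * F (sphArg θ p.1 p.2)) angleMeasure := by
    intro θ
    have hcont := continuous_sphArg θ
    exact Continuous.aestronglyMeasurable (by fun_prop)
  refine (hasDerivAt_integral_of_dominated_loc_of_deriv_le (s := univ)
    (F := fun θ p => G (cos p.1) * F (sphArg θ p.1 p.2) * angleWeight ν p)
    (F' := fun θ p => G (cos p.1) * (f (sphArg θ p.1 p.2) *
      (-sin θ * cos p.1 + cos θ * sin p.1 * cos p.2)) * angleWeight ν p)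
    (bound := fun p => Mg * (Mf * 2) * |angleWeight ν p|) Filter.univ_mem
    (Filter.Eventually.of_forall fun θ => (hmeas θ).mul hw.aestronglyMeasurable)
    (integrable_mul_angleWeight hν (M := Mg * MF) (hmeas θ) ?_) ?_ ?_
    (hw.abs.const_mul _) ?_).2
  · intro p
    rw [abs_mul]
    exact mul_le_mul (hg' _ (Real.abs_cos_le_one _)) (hF' _ (abs_sphArg_le_one _ _ _))
      (abs_nonneg _) hMg
  · have hcont := continuous_sphArg θ
    exact (Continuous.aestronglyMeasurable (by fun_prop)).mul hw.aestronglyMeasurable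
  · refine Filter.Eventually.of_forall fun p θ _ => ?_
    rw [Real.norm_eq_abs, abs_mul, abs_mul, abs_mul]
    gcongr
    · exact hg' _ (Real.abs_cos_le_one _)
    · exact hf' _ (abs_sphArg_le_one _ _ _)
    · exact abs_mul_add_mul_mul_le_two (Real.abs_sin_le_one _) (Real.abs_cos_le_one _)
        (Real.abs_cos_le_one _) (Real.abs_sin_le_one _) (Real.abs_cos_le_one _)
  · refine Filter.Eventually.of_forall fun p θ _ => ?_
    exact (((hF _).comp θ (hasDerivAt_sphArg_left θ p.1 p.2)).const_mul _).mul_const _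

theorem setIntegral_Ioo_deriv_eq_sub {h h' : ℝ → ℝ} (hc : Continuous h)
    (hd : ∀ t ∈ Ioo 0 Real.pi, HasDerivAt h (h' t) t) (hi : IntegrableOn h' (Ioo 0 Real.pi)) :
    ∫ t in Ioo 0 Real.pi, h' t = h Real.pi - h 0 := by
  rw [← integral_Ioc_eq_integral_Ioo, ← intervalIntegral.integral_of_le Real.pi_pos.le]
  exact intervalIntegral.integral_eq_sub_of_hasDerivAt_of_le Real.pi_pos.le hc.continuousOn hd
    ((intervalIntegrable_iff_integrableOn_Ioo_of_le Real.pi_pos.le).2 hi)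

/-- The divergence theorem on `(0, π)²` for the vector field with components
`sin θ · G(cos τ) f(W) sin^(2ν+1) τ sin^(2ν+1) φ` and `G(cos τ) f(W) ∂_τW sin^(2ν) τ sin^(2ν) φ`, where
`W = sphArg θ τ φ`. Both components vanish on the sides of the square to which they are normal. In
the divergence the terms with `f'` cancel, because `∂_φW = -sin θ sin τ sin φ`, and the remaining
terms combine to the two integrands below; on the left `G(cos τ) f(W)` is multiplied by `∂_θW`. -/
theorem integral_angle_divergence {ν : ℝ} (hν : 0 < ν) {f f' G g : ℝ → ℝ}
    (hf : ∀ u, HasDerivAt f (f' u) u) (hf' : Continuous f') (hG : ∀ u, HasDerivAt G (g u) u)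
    (hg : Continuous g) (θ : ℝ) :
    2 * ν * ∫ p, G (cos p.1) * (f (sphArg θ p.1 p.2) *
        (-sin θ * cos p.1 + cos θ * sin p.1 * cos p.2)) * angleWeight ν p ∂angleMeasure =
      -sin θ * ∫ p, g (cos p.1) * f (sphArg θ p.1 p.2) * angleWeight (ν + 1) p ∂angleMeasure := by
  have hfc : Continuous f := continuous_iff_continuousAt.2 fun u => (hf u).continuousAt
  have hGc : Continuous G := continuous_iff_continuousAt.2 fun u => (hG u).continuousAt
  obtain ⟨Mf, hMf, hfM⟩ := exists_abs_le_of_continuous hfc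
  obtain ⟨Mg, hMg, hGM⟩ := exists_abs_le_of_continuous hGc
  have hcont := continuous_sphArg θ
  have hp0 : Continuous fun φ => sin φ ^ (2 * ν) :=
    Real.continuous_sin.rpow_const fun _ => Or.inr (by linarith)
  have hp1 : Continuous fun φ => sin φ ^ (2 * ν + 1) :=
    Real.continuous_sin.rpow_const fun _ => Or.inr (by linarith)
  have hp2 : Continuous fun φ => sin φ ^ (2 * ν + 2) :=
    Real.continuous_sin.rpow_const fun _ => Or.inr (by linarith)
  -- the `τ`-derivative of the first component of the vector field
  let Xd : ℝ × ℝ → ℝ := fun p => sin θ * (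
    g (cos p.1) * (-sin p.1) * f (sphArg θ p.1 p.2) * sin p.1 ^ (2 * ν + 1)
      * sin p.2 ^ (2 * ν + 1)
    + G (cos p.1) * (f' (sphArg θ p.1 p.2) * (-cos θ * sin p.1 + sin θ * cos p.1 * cos p.2))
      * sin p.1 ^ (2 * ν + 1) * sin p.2 ^ (2 * ν + 1)
    + G (cos p.1) * f (sphArg θ p.1 p.2) * ((2 * ν + 1) * cos p.1 * sin p.1 ^ (2 * ν))
      * sin p.2 ^ (2 * ν + 1))
  -- the `φ`-derivative of its second component
  let Yd : ℝ × ℝ → ℝ := fun p =>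
    (G (cos p.1) * (f' (sphArg θ p.1 p.2) * (-(sin θ * sin p.1 * sin p.2))
        * (-cos θ * sin p.1 + sin θ * cos p.1 * cos p.2)
      + f (sphArg θ p.1 p.2) * (-(sin θ * cos p.1 * sin p.2)))
        * (sin p.1 ^ (2 * ν) * sin p.2 ^ (2 * ν)))
    + G (cos p.1) * f (sphArg θ p.1 p.2) * (2 * ν * cos p.2 *
        (-cos θ * sin p.1 + sin θ * cos p.1 * cos p.2)) * angleWeight ν p
  have hXi : Integrable Xd angleMeasure := by
    refine integrable_angleMeasure_of_continuous ?_
    have h1 : Continuous fun p : ℝ × ℝ => sin p.1 ^ (2 * ν + 1) := hp1.comp continuous_fst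
    have h2 : Continuous fun p : ℝ × ℝ => sin p.2 ^ (2 * ν + 1) := hp1.comp continuous_snd
    have h3 : Continuous fun p : ℝ × ℝ => sin p.1 ^ (2 * ν) := hp0.comp continuous_fst
    fun_prop
  have hbd : ∀ p : ℝ × ℝ, |-cos θ * sin p.1 + sin θ * cos p.1 * cos p.2| ≤ 2 := fun p =>
    abs_mul_add_mul_mul_le_two (Real.abs_cos_le_one _) (Real.abs_sin_le_one _)
      (Real.abs_sin_le_one _) (Real.abs_cos_le_one _) (Real.abs_cos_le_one _)
  have hYi : Integrable Yd angleMeasure := by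
    refine Integrable.add (integrable_angleMeasure_of_continuous ?_)
      (integrable_mul_angleWeight hν (M := Mg * Mf * (2 * ν * 1 * 2))
        (Continuous.aestronglyMeasurable (by fun_prop)) ?_)
    · have h1 : Continuous fun p : ℝ × ℝ => sin p.1 ^ (2 * ν) := hp0.comp continuous_fst
      have h2 : Continuous fun p : ℝ × ℝ => sin p.2 ^ (2 * ν) := hp0.comp continuous_snd
      fun_prop
    · intro p
      rw [abs_mul, abs_mul, abs_mul, abs_mul (2 * ν), abs_of_pos (by positivity : 0 < 2 * ν)]
      gcongr
      · exact hGM _ (Real.abs_cos_le_one _)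
      · exact hfM _ (abs_sphArg_le_one _ _ _)
      · exact Real.abs_cos_le_one _
      · exact hbd p
  have hX0 : ∫ p, Xd p ∂angleMeasure = 0 := by
    rw [angleMeasure, integral_prod_symm _ hXi]
    refine (integral_congr_ae ?_).trans (integral_zero ℝ ℝ)
    filter_upwards [Integrable.prod_left_ae hXi] with φ hφ
    rw [setIntegral_Ioo_deriv_eq_sub (h := fun τ => sin θ * (G (cos τ) * f (sphArg θ τ φ) *
      sin τ ^ (2 * ν + 1) * sin φ ^ (2 * ν + 1))) ?_ ?_ hφ]
    · have : (2 * ν + 1) ≠ 0 := by positivity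
      simp [Real.zero_rpow this]
    · have : Continuous fun τ => sphArg θ τ φ := by unfold sphArg; fun_prop
      fun_prop
    · intro τ hτ
      have hs := Real.sin_pos_of_mem_Ioo hτ
      refine ((((((hG _).comp τ (Real.hasDerivAt_cos τ)).mul
        ((hf _).comp τ (hasDerivAt_sphArg_mid θ τ φ))).mul
        ((Real.hasDerivAt_sin τ).rpow_const (p := 2 * ν + 1) (Or.inl hs.ne'))).mul_const
        (sin φ ^ (2 * ν + 1))).const_mul (sin θ)).congr_deriv ?_
      simp only [Xd, Function.comp_apply, add_sub_cancel_right, Pi.mul_apply]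
      ring
  have hY0 : ∫ p, Yd p ∂angleMeasure = 0 := by
    rw [angleMeasure, integral_prod _ hYi]
    refine (integral_congr_ae ?_).trans (integral_zero ℝ ℝ)
    filter_upwards [Integrable.prod_right_ae hYi] with τ hτ
    rw [setIntegral_Ioo_deriv_eq_sub (h := fun φ => G (cos τ) * (f (sphArg θ τ φ) *
      (-cos θ * sin τ + sin θ * cos τ * cos φ)) * (sin τ ^ (2 * ν) * sin φ ^ (2 * ν))) ?_ ?_ hτ]
    · have : 2 * ν ≠ 0 := by positivity
      simp [Real.zero_rpow this]
    · have : Continuous fun φ => sphArg θ τ φ := by unfold sphArg; fun_prop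
      fun_prop
    · intro φ hφ
      have hs := Real.sin_pos_of_mem_Ioo hφ
      refine (((((hf _).comp φ (hasDerivAt_sphArg_polar θ τ φ)).mul
        (((Real.hasDerivAt_cos φ).const_mul (sin θ * cos τ)).const_add
          (-cos θ * sin τ))).const_mul (G (cos τ))).mul
        (((Real.hasDerivAt_sin φ).rpow_const (p := 2 * ν) (Or.inl hs.ne')).const_mul
          (sin τ ^ (2 * ν)))).congr_deriv ?_
      simp only [Yd, angleWeight, Function.comp_apply, Pi.mul_apply]
      ring
  have hsum : ∫ p, (Xd p + Yd p) ∂angleMeasure = 0 := by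
    rw [integral_add hXi hYi, hX0, hY0, add_zero]
  have hi1 : Integrable (fun p : ℝ × ℝ => G (cos p.1) * (f (sphArg θ p.1 p.2) *
      (-sin θ * cos p.1 + cos θ * sin p.1 * cos p.2)) * angleWeight ν p) angleMeasure := by
    refine integrable_mul_angleWeight hν (M := Mg * (Mf * 2))
      (Continuous.aestronglyMeasurable (by fun_prop)) fun p => ?_
    rw [abs_mul, abs_mul]
    gcongr
    · exact hGM _ (Real.abs_cos_le_one _)
    · exact hfM _ (abs_sphArg_le_one _ _ _)
    · exact abs_mul_add_mul_mul_le_two (Real.abs_sin_le_one _) (Real.abs_cos_le_one _)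
        (Real.abs_cos_le_one _) (Real.abs_sin_le_one _) (Real.abs_cos_le_one _)
  have hi2 : Integrable (fun p : ℝ × ℝ => g (cos p.1) * f (sphArg θ p.1 p.2) *
      angleWeight (ν + 1) p) angleMeasure := by
    refine integrable_angleMeasure_of_continuous ?_
    have h1 : Continuous fun p : ℝ × ℝ => sin p.1 ^ (2 * (ν + 1)) := by
      have := hp2.comp (continuous_fst (X := ℝ) (Y := ℝ))
      have e : 2 * (ν + 1) = 2 * ν + 2 := by ring
      rw [e]; exact this
    have h2 : Continuous fun p : ℝ × ℝ => sin p.2 ^ (2 * (ν + 1) - 1) := by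
      have := hp1.comp (continuous_snd (X := ℝ) (Y := ℝ))
      have e : 2 * (ν + 1) - 1 = 2 * ν + 1 := by ring
      rw [e]; exact this
    unfold angleWeight
    fun_prop
  have key : ∫ p, (Xd p + Yd p) ∂angleMeasure =
      ∫ p, (-(2 * ν) * (G (cos p.1) * (f (sphArg θ p.1 p.2) *
        (-sin θ * cos p.1 + cos θ * sin p.1 * cos p.2)) * angleWeight ν p) -
      sin θ * (g (cos p.1) * f (sphArg θ p.1 p.2) * angleWeight (ν + 1) p)) ∂angleMeasure := by
    refine integral_congr_ae ?_
    filter_upwards [ae_angleMeasure_mem] with p hp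
    have hs1 := Real.sin_pos_of_mem_Ioo hp.1
    have hs2 := Real.sin_pos_of_mem_Ioo hp.2
    have e1 : sin p.1 ^ (2 * ν + 1) = sin p.1 ^ (2 * ν) * sin p.1 := Real.rpow_add_one hs1.ne' _
    have e2 : sin p.2 ^ (2 * ν + 1) = sin p.2 ^ (2 * ν - 1) * sin p.2 ^ 2 := by
      rw [← Real.rpow_two, ← Real.rpow_add hs2]; ring_nf
    have e3 : sin p.2 ^ (2 * ν) = sin p.2 ^ (2 * ν - 1) * sin p.2 := by
      rw [← Real.rpow_add_one hs2.ne']; ring_nf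
    have e4 : sin p.1 ^ (2 * (ν + 1)) = sin p.1 ^ (2 * ν) * sin p.1 ^ 2 := by
      rw [← Real.rpow_two, ← Real.rpow_add hs1]; ring_nf
    have e5 : sin p.2 ^ (2 * (ν + 1) - 1) = sin p.2 ^ (2 * ν - 1) * sin p.2 ^ 2 := by
      rw [← Real.rpow_two, ← Real.rpow_add hs2]; ring_nf
    simp only [Xd, Yd, angleWeight, e1, e2, e3, e4, e5]
    linear_combination (2 * ν * sin θ * cos p.1 * G (cos p.1) * f (sphArg θ p.1 p.2) *
      sin p.1 ^ (2 * ν) * sin p.2 ^ (2 * ν - 1)) * Real.sin_sq_add_cos_sq p.2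
  rw [key, integral_sub (hi1.const_mul _) (hi2.const_mul _), integral_const_mul,
    integral_const_mul] at hsum
  linarith

theorem kernelConst_add_one {ν : ℝ} (hν : 0 < ν) :
    2 * ν * kernelConst (ν + 1) = (2 * ν + 1) * kernelConst ν := by
  have h1 : Real.Gamma (ν + 1 + 1 / 2) = (ν + 1 / 2) * Real.Gamma (ν + 1 / 2) := by
    rw [← Real.Gamma_add_one (by positivity)]; ring_nf
  have hG := (Real.Gamma_pos_of_pos hν).ne'
  have hp : √Real.pi ≠ 0 := (Real.sqrt_pos.2 Real.pi_pos).ne'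
  rw [kernelConst, kernelConst, h1, Real.Gamma_add_one hν.ne']
  field_simp

theorem hasDerivAt_gegenbauerConv_of_pos {lam : ℝ} (hlam : 0 < lam) {F f f' G g : ℝ → ℝ}
    (hF : ∀ u, HasDerivAt F (f u) u) (hf : ∀ u, HasDerivAt f (f' u) u) (hf' : Continuous f')
    (hG : ∀ u, HasDerivAt G (g u) u) (hg : Continuous g) {x : ℝ} (hx : x ∈ Ioo (-1 : ℝ) 1) :
    HasDerivAt (gegenbauerConv lam F G) (gegenbauerConv (lam + 1) f g x / (2 * lam + 1)) x := by
  have hFc : Continuous F := continuous_iff_continuousAt.2 fun u => (hF u).continuousAt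
  have hfc : Continuous f := continuous_iff_continuousAt.2 fun u => (hf u).continuousAt
  have hGc : Continuous G := continuous_iff_continuousAt.2 fun u => (hG u).continuousAt
  have harc : ∀ y ∈ Ioo (-1 : ℝ) 1, Real.arccos y ∈ Ioo 0 Real.pi ∧ cos (Real.arccos y) = y :=
    fun y hy => ⟨⟨Real.arccos_pos.2 hy.2, Real.arccos_lt_pi.2 hy.1⟩,
      Real.cos_arccos hy.1.le hy.2.le⟩
  obtain ⟨hθ, hxθ⟩ := harc x hx
  have hs := Real.sin_pos_of_mem_Ioo hθ
  have hsq : √(1 - x ^ 2) = sin (Real.arccos x) := (Real.sin_arccos x).symm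
  have hd := ((hasDerivAt_integral_angle hlam hF hfc hGc (Real.arccos x)).comp x
    (Real.hasDerivAt_arccos hx.1.ne' hx.2.ne)).const_mul (kernelConst lam)
  rw [hsq] at hd
  have heq : gegenbauerConv lam F G =ᶠ[nhds x] fun y => kernelConst lam *
      ((fun θ => ∫ p, G (cos p.1) * F (sphArg θ p.1 p.2) * angleWeight lam p ∂angleMeasure) ∘
        Real.arccos) y := by
    filter_upwards [Ioo_mem_nhds hx.1 hx.2] with y hy
    obtain ⟨hy1, hy2⟩ := harc y hy
    rw [Function.comp_apply, ← gegenbauerConv_eq_integral_angle hlam hy1 hFc hGc, hy2]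
  refine (hd.congr_of_eventuallyEq heq).congr_deriv ?_
  have hdiv := integral_angle_divergence hlam hf hf' hG hg (Real.arccos x)
  have hconv := gegenbauerConv_eq_integral_angle (by linarith : 0 < lam + 1) hθ hfc hg
  rw [hxθ] at hconv
  have hk := kernelConst_add_one hlam
  obtain ⟨I, hI⟩ : ∃ I, I = ∫ p, G (cos p.1) * (f (sphArg (Real.arccos x) p.1 p.2) *
      (-sin (Real.arccos x) * cos p.1 + cos (Real.arccos x) * sin p.1 * cos p.2)) *
      angleWeight lam p ∂angleMeasure := ⟨_, rfl⟩
  rw [← hI] at hdiv ⊢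
  rw [hconv]
  have h1 : 2 * lam + 1 ≠ 0 := by positivity
  field_simp
  have h2 : 2 * lam ≠ 0 := by positivity
  apply mul_left_cancel₀ h2
  linear_combination (-(kernelConst lam * (2 * lam + 1))) * hdiv - sin (Real.arccos x) *
    (∫ p, g (cos p.1) * f (sphArg (Real.arccos x) p.1 p.2) * angleWeight (lam + 1) p
      ∂angleMeasure) * hk

/-- The case `lam = 0`: differentiate in `θ = arccos x`, integrate by parts over a period and fold
the period onto `(0, π)`; the kernel `C_1` contributes
`sin θ sin τ ∫ f(sphArg θ τ φ) sin φ dφ = F(cos (θ - τ)) - F(cos (θ + τ))`. -/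
theorem hasDerivAt_gegenbauerConv_zero {F f G g : ℝ → ℝ}
    (hF : ∀ u, HasDerivAt F (f u) u) (hf : Continuous f)
    (hG : ∀ u, HasDerivAt G (g u) u) (hg : Continuous g) {x : ℝ} (hx : x ∈ Ioo (-1 : ℝ) 1) :
    HasDerivAt (gegenbauerConv 0 F G) (gegenbauerConv 1 f g x) x := by
  have hFc : Continuous F := continuous_iff_continuousAt.2 fun u => (hF u).continuousAt
  have hGc : Continuous G := continuous_iff_continuousAt.2 fun u => (hG u).continuousAt
  set θ := Real.arccos x
  have hθ : θ ∈ Ioo 0 Real.pi := ⟨Real.arccos_pos.2 hx.2, Real.arccos_lt_pi.2 hx.1⟩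
  have hxθ : cos θ = x := Real.cos_arccos hx.1.le hx.2.le
  have hs := Real.sin_pos_of_mem_Ioo hθ
  have hsq : √(1 - x ^ 2) = sin θ := (Real.sin_arccos x).symm
  -- the derivative in the angle, by differentiation under the integral sign
  have hdθ : HasDerivAt (fun θ => ∫ t in (-Real.pi)..Real.pi, F (cos (θ - t)) * G (cos t))
      (∫ t in (-Real.pi)..Real.pi, f (cos (θ - t)) * -sin (θ - t) * G (cos t)) θ := by
    obtain ⟨Mf, hMf, hfM⟩ := exists_abs_le_of_continuous hf
    obtain ⟨Mg, hMg, hGM⟩ := exists_abs_le_of_continuous hGc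
    refine (intervalIntegral.hasDerivAt_integral_of_dominated_loc_of_deriv_le (s := univ)
      (F := fun θ t => F (cos (θ - t)) * G (cos t))
      (F' := fun θ t => f (cos (θ - t)) * -sin (θ - t) * G (cos t))
      (bound := fun _ => Mf * 1 * Mg) Filter.univ_mem
      (Filter.Eventually.of_forall fun θ => Continuous.aestronglyMeasurable (by fun_prop))
      (Continuous.intervalIntegrable (by fun_prop) _ _)
      (Continuous.aestronglyMeasurable (by fun_prop)) ?_ intervalIntegrable_const ?_).2
    · refine Filter.Eventually.of_forall fun t _ θ _ => ?_
      rw [Real.norm_eq_abs, abs_mul, abs_mul, abs_neg]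
      gcongr
      · exact hfM _ (Real.abs_cos_le_one _)
      · exact Real.abs_sin_le_one _
      · exact hGM _ (Real.abs_cos_le_one _)
    · refine Filter.Eventually.of_forall fun t _ θ _ => ?_
      exact ((hF _).comp θ (((Real.hasDerivAt_cos _).comp θ
        ((hasDerivAt_id θ).sub_const t)).congr_deriv (mul_one _))).mul_const _
  -- integration by parts in `t`; the boundary terms cancel by periodicity
  have hparts : ∫ t in (-Real.pi)..Real.pi, f (cos (θ - t)) * -sin (θ - t) * G (cos t) =
      -∫ t in (-Real.pi)..Real.pi, F (cos (θ - t)) * (g (cos t) * sin t) := by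
    have h := intervalIntegral.integral_mul_deriv_eq_deriv_mul (a := -Real.pi) (b := Real.pi)
      (u := fun t => F (cos (θ - t))) (v := fun t => G (cos t))
      (u' := fun t => f (cos (θ - t)) * sin (θ - t)) (v' := fun t => g (cos t) * -sin t)
      (fun t _ => (hF _).comp t (((Real.hasDerivAt_cos _).comp t
        ((hasDerivAt_id t).const_sub θ)).congr_deriv (by simp)))
      (fun t _ => (hG _).comp t (Real.hasDerivAt_cos t))
      (Continuous.intervalIntegrable (by fun_prop) _ _)
      (Continuous.intervalIntegrable (by fun_prop) _ _)
    have hb : cos (θ - -Real.pi) = cos (θ - Real.pi) := by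
      rw [sub_neg_eq_add, Real.cos_add_pi, Real.cos_sub_pi]
    simp only [hb, Real.cos_neg, sub_self, zero_sub, mul_neg,
      intervalIntegral.integral_neg, neg_mul] at h ⊢
    linarith
  have hfold : ∫ t in (-Real.pi)..Real.pi, F (cos (θ - t)) * (g (cos t) * sin t) =
      ∫ t in Ioo 0 Real.pi, (F (cos (θ - t)) - F (cos (θ + t))) * (g (cos t) * sin t) := by
    have hi : ∀ a b, IntervalIntegrable (fun t => F (cos (θ - t)) * (g (cos t) * sin t))
        volume a b := fun a b => Continuous.intervalIntegrable (by fun_prop) _ _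
    have hi' : IntervalIntegrable (fun t => F (cos (θ + t)) * (g (cos t) * sin t))
        volume 0 Real.pi := Continuous.intervalIntegrable (by fun_prop) _ _
    have hneg := intervalIntegral.integral_comp_neg
      (fun t => F (cos (θ - t)) * (g (cos t) * sin t)) (a := 0) (b := Real.pi)
    rw [← intervalIntegral.integral_add_adjacent_intervals (hi (-Real.pi) 0) (hi 0 Real.pi),
      ← integral_Ioc_eq_integral_Ioo, ← intervalIntegral.integral_of_le Real.pi_pos.le]
    simp only [sub_neg_eq_add, Real.cos_neg, Real.sin_neg, mul_neg, neg_zero,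
      intervalIntegral.integral_neg] at hneg
    rw [← hneg]
    simp only [sub_mul]
    rw [intervalIntegral.integral_sub (hi _ _) hi']
    ring
  have hinner : ∀ τ, sin θ * sin τ * ∫ φ in Ioo 0 Real.pi, sin φ * f (sphArg θ τ φ) =
      F (cos (θ - τ)) - F (cos (θ + τ)) := by
    intro τ
    have hcs : Continuous (sphArg θ τ) := by unfold sphArg; fun_prop
    have h := setIntegral_Ioo_deriv_eq_sub (h := fun φ => F (sphArg θ τ φ)) (by fun_prop)
      (fun φ _ => (hF _).comp φ (hasDerivAt_sphArg_polar θ τ φ))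
      ((Continuous.integrableOn_Ioc (by fun_prop)).mono_set Ioo_subset_Ioc_self)
    have e0 : sphArg θ τ 0 = cos (θ - τ) := by simp [sphArg, Real.cos_sub]
    have e1 : sphArg θ τ Real.pi = cos (θ + τ) := by
      simp [sphArg, Real.cos_add, sub_eq_add_neg]
    rw [e0, e1] at h
    rw [← integral_const_mul, ← neg_sub, ← h, ← integral_neg]
    refine integral_congr_ae (Filter.Eventually.of_forall fun φ => ?_)
    simp only
    ring
  have hk : kernelConst 1 = 1 / 2 := by
    have h := Real.Gamma_add_one (by norm_num : (1 / 2 : ℝ) ≠ 0)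
    rw [kernelConst, add_comm, h, Real.Gamma_one, Real.Gamma_one_half_eq]
    have hp : √Real.pi ≠ 0 := (Real.sqrt_pos.2 Real.pi_pos).ne'
    field_simp
  have hval : sin θ * gegenbauerConv 1 f g x = 1 / 2 *
      ∫ t in Ioo 0 Real.pi, (F (cos (θ - t)) - F (cos (θ + t))) * (g (cos t) * sin t) := by
    rw [← hxθ, gegenbauerConv_eq_iterated one_pos hθ, hk, mul_left_comm, ← integral_const_mul]
    congr 1
    refine integral_congr_ae (Filter.Eventually.of_forall fun τ => ?_)
    have e : (2 - 1 : ℝ) = 1 := by norm_num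
    simp only [← hinner, mul_one, e, Real.rpow_one, Real.rpow_two]
    ring
  have hd := (hdθ.comp x (Real.hasDerivAt_arccos hx.1.ne' hx.2.ne)).const_mul (1 / 2)
  have heq : gegenbauerConv 0 F G = fun y => 1 / 2 *
      ((fun θ => ∫ t in (-Real.pi)..Real.pi, F (cos (θ - t)) * G (cos t)) ∘ Real.arccos) y := by
    ext y; simp [gegenbauerConv]
  rw [heq]
  refine hd.congr_deriv ?_
  rw [hsq, hparts, hfold]
  generalize (∫ t in Ioo 0 Real.pi,
    (F (cos (θ - t)) - F (cos (θ + t))) * (g (cos t) * sin t)) = J at hval ⊢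
  field_simp
  linear_combination (-2) * hval

theorem hasDerivAt_gegenbauerConv {lam : ℝ} (hlam : 0 ≤ lam) {F f f' G g : ℝ → ℝ}
    (hF : ∀ u, HasDerivAt F (f u) u) (hf : ∀ u, HasDerivAt f (f' u) u) (hf' : Continuous f')
    (hG : ∀ u, HasDerivAt G (g u) u) (hg : Continuous g) {x : ℝ} (hx : x ∈ Ioo (-1 : ℝ) 1) :
    HasDerivAt (gegenbauerConv lam F G) (gegenbauerConv (lam + 1) f g x / (2 * lam + 1)) x := by
  rcases hlam.eq_or_lt with rfl | hpos
  · have hfc : Continuous f := continuous_iff_continuousAt.2 fun u => (hf u).continuousAt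
    simpa using hasDerivAt_gegenbauerConv_zero hF hfc hG hg hx
  · exact hasDerivAt_gegenbauerConv_of_pos hpos hF hf hf' hG hg hx

/-! ### Continuity of the convolution in its arguments -/

open Filter Topology in
/-- The convolution is continuous under bounded pointwise convergence of its arguments. -/
theorem tendsto_gegenbauerConv {lam : ℝ} (hlam : 0 ≤ lam) {F G : ℝ → ℝ} {Fn Gn : ℕ → ℝ → ℝ}
    {M : ℝ} (hM : 0 ≤ M) (hFn : ∀ n, Continuous (Fn n)) (hGn : ∀ n, Continuous (Gn n))
    (hF : Continuous F) (hG : Continuous G)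
    (hFM : ∀ n u, |Fn n u| ≤ M) (hGM : ∀ n u, |Gn n u| ≤ M)
    (hFt : ∀ u, Tendsto (fun n => Fn n u) atTop (𝓝 (F u)))
    (hGt : ∀ u, Tendsto (fun n => Gn n u) atTop (𝓝 (G u))) {x : ℝ} (hx : x ∈ Ioo (-1 : ℝ) 1) :
    Tendsto (fun n => gegenbauerConv lam (Fn n) (Gn n) x) atTop
      (𝓝 (gegenbauerConv lam F G x)) := by
  rcases hlam.eq_or_lt with rfl | hpos
  · simp only [gegenbauerConv, if_true]
    refine Tendsto.const_mul _ (intervalIntegral.tendsto_integral_filter_of_dominated_convergence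
      (fun _ => M * M) (Eventually.of_forall fun n => Continuous.aestronglyMeasurable ?_)
      (Eventually.of_forall fun n => Eventually.of_forall fun t _ => ?_)
      intervalIntegrable_const (Eventually.of_forall fun t _ => (hFt _).mul (hGt _)))
    · have := hFn n
      have := hGn n
      fun_prop
    · rw [Real.norm_eq_abs, abs_mul]
      exact mul_le_mul (hFM _ _) (hGM _ _) (abs_nonneg _) hM
  · have hθ : Real.arccos x ∈ Ioo 0 Real.pi :=
      ⟨Real.arccos_pos.2 hx.2, Real.arccos_lt_pi.2 hx.1⟩
    rw [← Real.cos_arccos hx.1.le hx.2.le, gegenbauerConv_eq_integral_angle hpos hθ hF hG]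
    simp only [gegenbauerConv_eq_integral_angle hpos hθ (hFn _) (hGn _)]
    have hw := integrable_angleWeight hpos
    refine Tendsto.const_mul _ (tendsto_integral_of_dominated_convergence
      (fun p => M * M * |angleWeight lam p|) (fun n => ?_) (hw.abs.const_mul _)
      (fun n => Eventually.of_forall fun p => ?_)
      (Eventually.of_forall fun p => ((hGt _).mul (hFt _)).mul_const _))
    · have := hFn n
      have := hGn n
      have := continuous_sphArg (Real.arccos x)
      exact (Continuous.aestronglyMeasurable (by fun_prop)).mul hw.aestronglyMeasurable
    · rw [Real.norm_eq_abs, abs_mul, abs_mul]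
      gcongr
      · exact hGM _ _
      · exact hFM _ _

/-- The kernel `C_ν(x, y, z)` at `p = (y, z)`, multiplied by the densities of `dΩ_ν(y)` and `dΩ_ν(z)`.
It equals a constant times `Δ^(ν-1) (1 - x²)^(1/2-ν)` on `Δ > 0`. -/
def weightedKernel (ν x : ℝ) (p : ℝ × ℝ) : ℝ :=
  (1 - p.1 ^ 2) ^ (ν - 1 / 2) * (1 - p.2 ^ 2) ^ (ν - 1 / 2) * gegenbauerKernel ν x p.1 p.2

theorem measurable_weightedKernel (ν x : ℝ) : Measurable (weightedKernel ν x) := by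
  have hΔ : Measurable fun p : ℝ × ℝ => gegenbauerDelta x p.1 p.2 := by
    unfold gegenbauerDelta; fun_prop
  have h : Measurable fun p : ℝ × ℝ => gegenbauerKernel ν x p.1 p.2 := by
    unfold gegenbauerKernel
    exact Measurable.ite (measurableSet_lt measurable_const hΔ) (by fun_prop) measurable_const
  unfold weightedKernel
  fun_prop

theorem kernelConst_pos {ν : ℝ} (hν : 0 < ν) : 0 < kernelConst ν :=
  div_pos (Real.Gamma_pos_of_pos (by positivity))
    (mul_pos (Real.sqrt_pos.2 Real.pi_pos) (Real.Gamma_pos_of_pos hν))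

/-- For `ν ≥ 1` the kernel is a bounded function on the square, because `0 < Δ ≤ 1` on its support. -/
theorem abs_weightedKernel_le {ν x : ℝ} (hν : 1 ≤ ν) (hx : x ∈ Ioo (-1 : ℝ) 1) {p : ℝ × ℝ}
    (hp : p ∈ Ioo (-1 : ℝ) 1 ×ˢ Ioo (-1 : ℝ) 1) :
    |weightedKernel ν x p| ≤ kernelConst ν * (1 - x ^ 2) ^ (1 / 2 - ν) := by
  obtain ⟨⟨hy1, hy2⟩, hz1, hz2⟩ := hp
  have hc := kernelConst_pos (zero_lt_one.trans_le hν)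
  have hX : 0 < 1 - x ^ 2 := by nlinarith [hx.1, hx.2]
  have hY : 0 < 1 - p.1 ^ 2 := by nlinarith
  have hZ : 0 < 1 - p.2 ^ 2 := by nlinarith
  unfold weightedKernel gegenbauerKernel
  split_ifs with h
  · have hΔ : gegenbauerDelta x p.1 p.2 ≤ 1 := by
      unfold gegenbauerDelta
      nlinarith [sq_nonneg (p.1 - x * p.2), mul_nonneg (sq_nonneg x) hZ.le, sq_nonneg p.2]
    have hone : ∀ s : ℝ, 0 < s → s ^ (ν - 1 / 2) * s ^ (1 / 2 - ν) = 1 := fun s hs => by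
      rw [← Real.rpow_add hs]; norm_num
    rw [Real.mul_rpow (by positivity) hZ.le, Real.mul_rpow hX.le hY.le,
      show (1 - p.1 ^ 2) ^ (ν - 1 / 2) * (1 - p.2 ^ 2) ^ (ν - 1 / 2) *
        (Real.Gamma (ν + 1 / 2) / (√Real.pi * Real.Gamma ν) *
          gegenbauerDelta x p.1 p.2 ^ (ν - 1) *
          ((1 - x ^ 2) ^ (1 / 2 - ν) * (1 - p.1 ^ 2) ^ (1 / 2 - ν) *
            (1 - p.2 ^ 2) ^ (1 / 2 - ν))) =
        kernelConst ν * (1 - x ^ 2) ^ (1 / 2 - ν) * gegenbauerDelta x p.1 p.2 ^ (ν - 1) *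
        ((1 - p.1 ^ 2) ^ (ν - 1 / 2) * (1 - p.1 ^ 2) ^ (1 / 2 - ν)) *
        ((1 - p.2 ^ 2) ^ (ν - 1 / 2) * (1 - p.2 ^ 2) ^ (1 / 2 - ν)) by
        rw [kernelConst]; ring,
      hone _ hY, hone _ hZ, mul_one, mul_one, abs_of_nonneg (by positivity)]
    exact mul_le_of_le_one_right (by positivity)
      (Real.rpow_le_one h.le hΔ (by linarith))
  · rw [mul_zero, abs_zero]
    positivity

/-- For `ν ≥ 1` the convolution is continuous from `L¹ × L¹` to the functions on `(-1, 1)` with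
locally uniform convergence. -/
theorem abs_gegenbauerConv_sub_le {ν x : ℝ} (hν : 1 ≤ ν) (hx : x ∈ Ioo (-1 : ℝ) 1)
    {f f' g g' : ℝ → ℝ} (hf : Integrable f) (hf' : Integrable f') (hg : Integrable g)
    (hg' : Integrable g') :
    |gegenbauerConv ν f g x - gegenbauerConv ν f' g' x| ≤
      kernelConst ν * (1 - x ^ 2) ^ (1 / 2 - ν) *
        ((∫ u, |f u - f' u|) * (∫ u, |g u|) + (∫ u, |f' u|) * ∫ u, |g u - g' u|) := by
  set m : Measure ℝ := volume.restrict (Ioo (-1 : ℝ) 1) with hm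
  set K := kernelConst ν * (1 - x ^ 2) ^ (1 / 2 - ν)
  have hX : 0 < 1 - x ^ 2 := by nlinarith [hx.1, hx.2]
  have hK0 : 0 ≤ K := mul_nonneg (kernelConst_pos (zero_lt_one.trans_le hν)).le
    (Real.rpow_nonneg hX.le _)
  have hbd : ∀ᵐ p ∂(m.prod m), ‖weightedKernel ν x p‖ ≤ K := by
    rw [hm, Measure.prod_restrict]
    filter_upwards [ae_restrict_mem (measurableSet_Ioo.prod measurableSet_Ioo)] with p hp
    exact abs_weightedKernel_le hν hx hp
  have hint : ∀ {a b : ℝ → ℝ}, Integrable a → Integrable b →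
      Integrable (fun p : ℝ × ℝ => a p.1 * b p.2) (m.prod m) := fun ha hb =>
    Integrable.mul_prod ha.integrableOn hb.integrableOn
  have hker : ∀ {h : ℝ × ℝ → ℝ}, Integrable h (m.prod m) →
      Integrable (fun p => weightedKernel ν x p * h p) (m.prod m) := fun hh =>
    hh.bdd_mul (measurable_weightedKernel ν x).aestronglyMeasurable hbd
  have hconv : ∀ {a b : ℝ → ℝ}, Integrable a → Integrable b → gegenbauerConv ν a b x =
      ∫ p, weightedKernel ν x p * (a p.1 * b p.2) ∂(m.prod m) := by
    intro a b ha hb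
    rw [integral_prod_symm _ (hker (hint ha hb)), gegenbauerConv,
      if_neg (zero_lt_one.trans_le hν).ne']
    simp only [integral_gegenbauerMeasure, ← integral_const_mul]
    refine integral_congr_ae (Filter.Eventually.of_forall fun z => ?_)
    refine integral_congr_ae (Filter.Eventually.of_forall fun y => ?_)
    simp only [weightedKernel]
    ring
  have hset : ∀ {a : ℝ → ℝ}, Integrable a → ∫ u, |a u| ∂m ≤ ∫ u, |a u| := fun ha =>
    setIntegral_le_integral ha.abs (Filter.Eventually.of_forall fun u => abs_nonneg _)
  have hd1 : Integrable (fun p : ℝ × ℝ => |f p.1 - f' p.1| * |g p.2|) (m.prod m) :=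
    hint (hf.sub hf').abs hg.abs
  have hd2 : Integrable (fun p : ℝ × ℝ => |f' p.1| * |g p.2 - g' p.2|) (m.prod m) :=
    hint hf'.abs (hg.sub hg').abs
  rw [hconv hf hg, hconv hf' hg', ← integral_sub (hker (hint hf hg)) (hker (hint hf' hg'))]
  calc |∫ p, (weightedKernel ν x p * (f p.1 * g p.2) -
          weightedKernel ν x p * (f' p.1 * g' p.2)) ∂(m.prod m)|
      ≤ ∫ p, K * (|f p.1 - f' p.1| * |g p.2| + |f' p.1| * |g p.2 - g' p.2|) ∂(m.prod m) := by
        rw [← Real.norm_eq_abs]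
        refine norm_integral_le_of_norm_le ((hd1.add hd2).const_mul K) ?_
        filter_upwards [hbd] with p hp
        rw [← mul_sub, norm_mul]
        refine mul_le_mul hp ?_ (norm_nonneg _) hK0
        rw [Real.norm_eq_abs, ← abs_mul, ← abs_mul,
          show f p.1 * g p.2 - f' p.1 * g' p.2 =
            (f p.1 - f' p.1) * g p.2 + f' p.1 * (g p.2 - g' p.2) by ring]
        exact abs_add_le _ _
    _ = K * ((∫ u, |f u - f' u| ∂m) * (∫ u, |g u| ∂m) +
          (∫ u, |f' u| ∂m) * ∫ u, |g u - g' u| ∂m) := by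
        rw [integral_const_mul, integral_add hd1 hd2,
          integral_prod_mul (fun u => |f u - f' u|) (fun u => |g u|),
          integral_prod_mul (fun u => |f' u|) (fun u => |g u - g' u|)]
    _ ≤ _ := by
        have n : ∀ {a : ℝ → ℝ} {μ : Measure ℝ}, 0 ≤ ∫ u, |a u| ∂μ := fun {a μ} =>
          integral_nonneg fun u => abs_nonneg _
        refine mul_le_mul_of_nonneg_left (add_le_add ?_ ?_) hK0
        · exact mul_le_mul (hset (hf.sub hf')) (hset hg) n n
        · exact mul_le_mul (hset hf') (hset (hg.sub hg')) n n

/-! ### Approximation of integrable functions -/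

theorem exists_contDiff_approx {f : ℝ → ℝ} (hf : Integrable f) : ∃ fn : ℕ → ℝ → ℝ, ∀ n,
    ContDiff ℝ 1 (fn n) ∧ Integrable (fn n) ∧ ∫ u, |f u - fn n u| ≤ 1 / ((n : ℝ) + 1) := by
  have h : ∀ n : ℕ, ∃ g : ℝ → ℝ, ContDiff ℝ 1 g ∧ Integrable g ∧
      ∫ u, |f u - g u| ≤ 1 / ((n : ℝ) + 1) := by
    intro n
    obtain ⟨g, hg1, hg2, hg3⟩ := MemLp.exist_eLpNorm_sub_le (p := 1) (by simp) le_rfl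
      (memLp_one_iff_integrable.2 hf) (by positivity : 0 < 1 / ((n : ℝ) + 1))
    have hgi : Integrable g := hg2.continuous.integrable_of_hasCompactSupport hg1
    refine ⟨g, hg2.of_le (by exact_mod_cast le_top), hgi, ?_⟩
    have h1 := integral_norm_eq_lintegral_enorm (hf.sub hgi).aestronglyMeasurable
    rw [← eLpNorm_one_eq_lintegral_enorm] at h1
    calc ∫ u, |f u - g u| = ∫ u, ‖(f - g) u‖ := rfl
      _ ≤ _ := by
        rw [h1]
        exact ENNReal.toReal_le_of_le_ofReal (by positivity) hg3
  choose fn hfn using h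
  exact ⟨fn, hfn⟩

theorem abs_montee_sub_le {f g : ℝ → ℝ} (hf : Integrable f) (hg : Integrable g) (x : ℝ) :
    |montee f x - montee g x| ≤ ∫ u, |f u - g u| := by
  rw [montee, montee, ← intervalIntegral.integral_sub hf.intervalIntegrable hg.intervalIntegrable]
  rw [← Real.norm_eq_abs]
  refine (intervalIntegral.norm_integral_le_integral_norm_uIoc).trans ?_
  exact setIntegral_le_integral (hf.sub hg).abs (Filter.Eventually.of_forall fun u => abs_nonneg _)

theorem continuous_montee {f : ℝ → ℝ} (hf : Integrable f) : Continuous (montee f) :=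
  intervalIntegral.continuous_primitive (fun _ _ => hf.intervalIntegrable) _

theorem hasDerivAt_montee {f : ℝ → ℝ} (hf : Continuous f) (x : ℝ) :
    HasDerivAt (montee f) (f x) x :=
  intervalIntegral.integral_hasDerivAt_right (hf.intervalIntegrable _ _)
    (hf.stronglyMeasurableAtFilter _ _) hf.continuousAt

open Filter Topology in
/-- For integrable `f` and `g` the derivative formula holds at every point of `(-1, 1)`: it passes
from `C¹` functions to their `L¹` limits since the convolutions of index `lam` converge pointwise
and those of index `lam + 1` converge uniformly on `(-r, r)` for every `r < 1`. -/
theorem hasDerivAt_gegenbauerConv_montee {lam : ℝ} (hlam : 0 ≤ lam) {f g : ℝ → ℝ}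
    (hf : Integrable f) (hg : Integrable g) {x : ℝ} (hx : x ∈ Ioo (-1 : ℝ) 1) :
    HasDerivAt (gegenbauerConv lam (montee f) (montee g))
      (gegenbauerConv (lam + 1) f g x / (2 * lam + 1)) x := by
  obtain ⟨fn, hfn⟩ := exists_contDiff_approx hf
  obtain ⟨gn, hgn⟩ := exists_contDiff_approx hg
  obtain ⟨r, hr, hr1⟩ := exists_between (abs_lt.2 hx)
  have hr0 : 0 ≤ r := (abs_nonneg x).trans hr.le
  have hsub : Ioo (-r) r ⊆ Ioo (-1) 1 := Ioo_subset_Ioo (by linarith) hr1.le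
  have hδ : Tendsto (fun n : ℕ => 1 / ((n : ℝ) + 1)) atTop (𝓝 0) :=
    tendsto_one_div_add_atTop_nhds_zero_nat
  have hδ1 : ∀ n : ℕ, 1 / ((n : ℝ) + 1) ≤ 1 := fun n => by
    rw [div_le_one (by positivity)]
    linarith [n.cast_nonneg (α := ℝ)]
  have h2 : 0 < 2 * lam + 1 := by positivity
  -- the constant `1` dominates the `L¹` errors `1 / (n + 1)`
  have hmont : ∀ {a b : ℝ → ℝ} {n : ℕ}, Integrable a → Integrable b →
      ∫ u, |a u - b u| ≤ 1 / ((n : ℝ) + 1) → ∀ u, |montee b u| ≤ (∫ u, |a u|) + 1 := by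
    intro a b n ha hb hab u
    have h1 := abs_montee_sub_le ha hb u
    have h2 := abs_montee_sub_le (g := fun _ => 0) ha (integrable_zero ℝ ℝ volume) u
    have h3 : montee (fun _ => (0 : ℝ)) u = 0 := by simp [montee]
    simp only [h3, sub_zero] at h2
    have h4 := abs_sub_abs_le_abs_sub (montee b u) (montee a u)
    rw [abs_sub_comm] at h4
    linarith [hδ1 n]
  have hnn : ∀ {a : ℝ → ℝ}, 0 ≤ ∫ u, |a u| := fun {a} => integral_nonneg fun u => abs_nonneg _
  have htm : ∀ {a : ℝ → ℝ} {an : ℕ → ℝ → ℝ}, Integrable a → (∀ n, ContDiff ℝ 1 (an n) ∧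
      Integrable (an n) ∧ ∫ u, |a u - an n u| ≤ 1 / ((n : ℝ) + 1)) →
      ∀ u, Tendsto (fun n => montee (an n) u) atTop (𝓝 (montee a u)) := by
    intro a an ha han u
    rw [tendsto_iff_dist_tendsto_zero]
    refine squeeze_zero (fun _ => dist_nonneg) (fun n => ?_) hδ
    rw [dist_comm, Real.dist_eq]
    exact (abs_montee_sub_le ha (han n).2.1 u).trans (han n).2.2
  refine hasDerivAt_of_tendstoUniformlyOn (s := Ioo (-r) r) (l := atTop)
    (f := fun n => gegenbauerConv lam (montee (fn n)) (montee (gn n)))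
    (f' := fun n y => gegenbauerConv (lam + 1) (fn n) (gn n) y / (2 * lam + 1))
    (g' := fun y => gegenbauerConv (lam + 1) f g y / (2 * lam + 1)) isOpen_Ioo ?_ ?_ ?_
    (abs_lt.1 hr)
  · set K := kernelConst (lam + 1) * (1 - r ^ 2) ^ (1 / 2 - (lam + 1))
    have hlim : Tendsto (fun n : ℕ => K * (1 / ((n : ℝ) + 1) * (∫ u, |g u|) +
        ((∫ u, |f u|) + 1) * (1 / ((n : ℝ) + 1))) / (2 * lam + 1)) atTop (𝓝 0) := by
      have := (((hδ.mul_const (∫ u, |g u|)).add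
        (hδ.const_mul ((∫ u, |f u|) + 1))).const_mul K).div_const (2 * lam + 1)
      simpa using this
    rw [Metric.tendstoUniformlyOn_iff]
    intro ε hε
    filter_upwards [hlim.eventually_lt_const hε] with n hn y hy
    refine lt_of_le_of_lt ?_ hn
    rw [Real.dist_eq, ← sub_div, abs_div, abs_of_pos h2]
    gcongr
    have hyr : y ^ 2 ≤ r ^ 2 := sq_le_sq' hy.1.le hy.2.le
    have hR : 0 < 1 - r ^ 2 := by nlinarith
    have hkc := kernelConst_pos (by positivity : 0 < lam + 1)
    refine (abs_gegenbauerConv_sub_le (by linarith) (hsub hy) hf (hfn n).2.1 hg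
      (hgn n).2.1).trans ?_
    have hfb : ∫ u, |fn n u| ≤ (∫ u, |f u|) + 1 := by
      have hfd : Integrable fun u => |f u - fn n u| := (hf.sub (hfn n).2.1).abs
      have h1 : ∫ u, |fn n u| ≤ ∫ u, (|f u| + |f u - fn n u|) :=
        integral_mono (hfn n).2.1.abs (hf.abs.add hfd) fun u => by
          have := abs_sub_abs_le_abs_sub (fn n u) (f u)
          rw [abs_sub_comm] at this
          simp only
          linarith
      rw [integral_add hf.abs hfd] at h1
      linarith [(hfn n).2.2, hδ1 n]
    refine mul_le_mul ?_ (add_le_add ?_ ?_)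
      (add_nonneg (mul_nonneg hnn hnn) (mul_nonneg hnn hnn)) (by positivity)
    · refine mul_le_mul_of_nonneg_left ?_ hkc.le
      exact Real.rpow_le_rpow_of_nonpos hR (by linarith) (by linarith)
    · exact mul_le_mul_of_nonneg_right (hfn n).2.2 hnn
    · exact mul_le_mul hfb (hgn n).2.2 hnn (add_nonneg hnn zero_le_one)
  · refine Eventually.of_forall fun n y hy => ?_
    have hc := (hfn n).1
    exact hasDerivAt_gegenbauerConv hlam (hasDerivAt_montee hc.continuous)
      (fun u => (hc.differentiable one_ne_zero u).hasDerivAt) (hc.continuous_deriv le_rfl)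
      (hasDerivAt_montee (hgn n).1.continuous) (hgn n).1.continuous (hsub hy)
  · intro y hy
    refine tendsto_gegenbauerConv hlam (M := (∫ u, |f u|) + (∫ u, |g u|) + 1) ?_
      (fun n => continuous_montee (hfn n).2.1) (fun n => continuous_montee (hgn n).2.1)
      (continuous_montee hf) (continuous_montee hg) (fun n u => ?_) (fun n u => ?_)
      (htm hf hfn) (htm hg hgn) (hsub hy)
    · linarith [hnn (a := f), hnn (a := g)]
    · linarith [hmont hf (hfn n).2.1 (hfn n).2.2 u, hnn (a := g)]
    · linarith [hmont hg (hgn n).2.1 (hgn n).2.2 u, hnn (a := f)]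

theorem montee_indicator (f : ℝ → ℝ) :
    EqOn (montee f) (montee ((Icc (-1) 1).indicator f)) (Icc (-1) 1) := by
  intro x hx
  refine intervalIntegral.integral_congr fun u hu => ?_
  rw [uIcc_of_le hx.1] at hu
  have hu' : u ∈ Icc (-1 : ℝ) 1 := ⟨hu.1, hu.2.trans hx.2⟩
  exact (indicator_of_mem hu' f).symm

end SphereConv

end

theorem theorem4p1 (lam : ℝ) (hlam : 0 ≤ lam) (f g : ℝ → ℝ)
    (hf : IntegrableOn f (Icc (-1 : ℝ) 1) volume)
    (hg : IntegrableOn g (Icc (-1 : ℝ) 1) volume)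
    (hac : SphereConv.HasACRepresentative
      (SphereConv.gegenbauerConv lam (SphereConv.montee f) (SphereConv.montee g))) :
    ∀ᵐ x ∂(volume.restrict (Icc (-1 : ℝ) 1)),
      DifferentiableAt ℝ
        (SphereConv.gegenbauerConv lam (SphereConv.montee f) (SphereConv.montee g)) x ∧
      SphereConv.gegenbauerConv (lam + 1) f g x =
        (2 * lam + 1) * SphereConv.descente
          (SphereConv.gegenbauerConv lam (SphereConv.montee f) (SphereConv.montee g)) x := by
  rw [← Measure.restrict_congr_set (Ioo_ae_eq_Icc (μ := volume) (a := (-1 : ℝ)) (b := 1))]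
  filter_upwards [ae_restrict_mem measurableSet_Ioo] with x hx
  have hi : ∀ a : ℝ → ℝ, EqOn a ((Icc (-1) 1).indicator a) (Icc (-1) 1) := fun a u hu =>
    (indicator_of_mem hu a).symm
  have h := SphereConv.hasDerivAt_gegenbauerConv_montee hlam
    ((integrable_indicator_iff measurableSet_Icc).2 hf)
    ((integrable_indicator_iff measurableSet_Icc).2 hg) hx
  rw [← SphereConv.gegenbauerConv_congr lam (SphereConv.montee_indicator f)
    (SphereConv.montee_indicator g),
    ← SphereConv.gegenbauerConv_congr (lam + 1) (hi f) (hi g)] at h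
  refine ⟨h.differentiableAt, ?_⟩
  rw [SphereConv.descente, h.deriv]
  have h2 : 2 * lam + 1 ≠ 0 := by positivity
  field_simp
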